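/- **Setting.** Let $A$ be a finite totally ordered alphabet with an involution $x\mapsto x^{-1}$, extended to words by $(x_1\cdots x_p)^{-1}=x_p^{-1}\cdots x_1^{-1}$; let $<$ be the short-lex order on $A^*$ (length first, then lexicographic). A *rule* is a pair $(\lambda,\rho)$ of words with $\lambda>\rho$. Let $SL2$ be the set of pairs $(u,v)$ with no common non-empty prefix, $u>v$ and $|v|\le|u|\le|v|+2$. Let $D$ be a finite set of pairs in $SL2$ (the relators of a finitely presented group $\langle A\mid xx^{-1}\ (x\in A),\ l=r\ ((l,r)\in D)\rangle$, written as rules). **The procedure.** Its data are a finite set $\mathsf S$ of rules, the disjoint union of $\mathsf{Considered}$, $\mathsf{Now}$, $\mathsf{New}$ and $\mathsf{Delete}$, and two finite two-variable automata $Rules$ and $WDiff$, each with one state that is both the initial and the final state, whose states carry words representing the corresponding word differences. Initially $\mathsf{New}$ consists of $D$ and all rules $(xx^{-1},\epsilon)$, the other parts of $\mathsf S$ are empty, and $Rules=WDiff$ is obtained by welding together the linear automata of these rules. (Welding: identify states until the automaton and its reversal are deterministic with one initial = final state; every arrow labelled $(x,x)$ with an end at the initial state is made a loop and omitted.) A word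 is *Aut-reducible* if it contains the left-hand side of an element of $L(Rules)\cap SL2$. To *Aut-reduce* a word, repeat as long as possible: choose a reducible subword $\lambda$ all of whose proper subwords are irreducible; if $\mathsf S$ has a rule with left-hand side $\lambda$, let $\rho$ be the least right-hand side of such a rule; otherwise let $\rho$ be the least word with $(\lambda,\rho)\in L(Rules)\cap SL2$ and insert $(\lambda,\rho)$ into $\mathsf{New}$; replace $\lambda$ by $\rho$. *Minimization* of a rule $(u,v)$, with $u=u_1\cdots u_p$ and $v=v_1\cdots v_q$ denoting the current pair: 1. Aut-reduce $u_1\cdots u_{p-1}$; if this changes it, go to step 3. 2. Aut-reduce $u_2\cdots u_p$. 3. If $u$ has changed, Aut-reduce $u$. 4. Aut-reduce $v$. 5. If $v>u$, interchange $u$ and $v$. 6. While $p>q+2$, or $p=q+2$, $q>0$, $u_1>v_1$, or $p=2$, $q=0$, $u_1>u_2^{-1}$: replace $(u,v)$ by $(u_1\cdots u_{p-1},\,v u_p^{-1})$. 7. If $p=q+2$ and $u_2>u_1^{-1}$: replace $(u,v)$ by $(u_2\cdots u_p,\,u_1^{-1}v)$. 8. Cancel common first letters. 9. Cancel common last letters.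 10. If $(u,v)$ has changed since step 4, go to step 4; otherwise output $(u,v)$. *Handling* the output $(\lambda_1,\rho_1)$ of the minimization of $(\lambda,\rho)$: if it is not $(\epsilon,\epsilon)$, weld it into $WDiff$, marking its states and arrows as needed, insert it into $\mathsf{Now}$ unless it is in $\mathsf{Now}$ or $\mathsf{Considered}$, remove it from $\mathsf{New}$, and Aut-reduce the words attached to the states of $WDiff$. Then, if some proper subword of $\lambda$ is Aut-reducible, delete $(\lambda,\rho)$ from $\mathsf S$; otherwise, if $(\lambda_1,\rho_1)\neq(\lambda,\rho)$, move $(\lambda,\rho)$ to $\mathsf{Delete}$. The procedure consists of successive *passes*. In a pass, (a) minimize each rule in $\mathsf{Considered}$ and handle the output; (b) do the same with rules in $\mathsf{New}$ until $\mathsf{New}$ is empty; (c) until $\mathsf{Now}$ is empty, move a rule from $\mathsf{Now}$ to $\mathsf{Considered}$ and, for each overlap of its left-hand side with that of a rule in $\mathsf{Considered}$ (a non-empty suffix of one equal to a prefix of the other), Aut-reduce the two words obtained from the overlap; if the results $a,b$ differ, say $a>b$, insert $(a,b)$ into $\mathsf{New}$ unless it is already in $\mathsf S$; (d) delete from $WDiff$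 what is not marked as needed, then repeatedly Aut-reduce, with $WDiff$ in place of $Rules$, the words attached to its states and identify (by welding) states with equal words, until these words are distinct and irreducible; let this automaton be the new $Rules$ and remove all marks; (e) delete all rules in $\mathsf{Delete}$. Choices left open are arbitrary. Time is counted in elementary steps, where moving a rule between parts of $\mathsf S$ and one replacement in Aut-reduction (with the possible insertion) are single steps. **Thue paths.** A *time-$t$ Thue path* from $u$ to $v$ is a finite sequence of elementary reductions $s_1\lambda s_2\to s_1\rho s_2$ and inverses of such reductions that connects $u$ to $v$, where each $(\lambda,\rho)$ used is in $\mathsf S$ but not in $\mathsf{Delete}$ at time $t$. Its *nodes* are the words occurring in it (the node of the empty path from $u$ to $u$ is $u$). **Proposition.** Consider any execution of the procedure and let $t\ge0$. If there is a time-$t$ Thue path from $u$ to $v$ with maximal node $w$, then for every time $s\ge t$ of the execution there is a time-$s$ Thue path from $u$ to $v$ all of whose nodes are $\le w$. -/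

import Mathlib

namespace KB

/-! ## Words, rules and the short-lex order -/

/-- Words over the alphabet `A`. -/
abbrev Word (A : Type*) := List A

/-- A pair of words; a rule is such a pair with left-hand side greater than right-hand side. -/
abbrev Rule (A : Type*) := List A × List A

section Words

variable {A : Type*} [LinearOrder A]

/-- The strict short-lex order on words: first by length, then lexicographically. -/
def Lt (u v : Word A) : Prop := List.Shortlex (· < ·) u v

/-- The short-lex order on words. -/
def Le (u v : Word A) : Prop := Lt u v ∨ u = v

/-- The formal inverse of a word, `(x₁ … xₚ)⁻¹ = xₚ⁻¹ … x₁⁻¹`. -/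
def invWord (inv : A → A) (w : Word A) : Word A := (w.map inv).reverse

/-- The language of the five-state automaton `SL2`: pairs `(u, v)` without a common non-trivial
prefix such that `u > v` and `|v| ≤ |u| ≤ |v| + 2`. -/
def SL2 (r : Rule A) : Prop :=
  (¬ ∃ x u' v', r.1 = x :: u' ∧ r.2 = x :: v') ∧
    Lt r.2 r.1 ∧ r.2.length ≤ r.1.length ∧ r.1.length ≤ r.2.length + 2

end Words

/-! ## Two-variable automata and welding -/

/-- Labels `(x, y) ∈ A⁺ × A⁺` of arrows, where `none` is the padding symbol. -/
abbrev Label (A : Type*) := Option A × Option A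

/-- An arrow `(source, label, target)`. -/
abbrev Arrow (A : Type*) := ℕ × Label A × ℕ

/-- The padded word `(u, v)⁺`. -/
def pad {A : Type*} : Word A → Word A → List (Label A)
  | [], [] => []
  | x :: u, [] => (some x, none) :: pad u []
  | [], y :: v => (none, some y) :: pad [] v
  | x :: u, y :: v => (some x, some y) :: pad u v

/-- `TracePath E s l t`: the arrows in `E` contain a path from `s` to `t` with label `l`. -/
def TracePath {A : Type*} (E : Finset (Arrow A)) : ℕ → List (Label A) → ℕ → Prop
  | s, [], t => s = t
  | s, a :: l, t => ∃ m, (s, a, m) ∈ E ∧ TracePath E m l t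

/-- A two-variable automaton whose unique initial state and unique final state are both `0`.
The automata that occur are trim, so their states are `0` and the end points of the arrows.
`needed` is the set of arrows marked as needed; the states marked as needed are the end points of
these arrows. `label s` is the word attached to the state `s`; it represents the group element
that makes the automaton a rule automaton. -/
structure Aut (A : Type*) where
  arrows : Finset (Arrow A)
  needed : Finset (Arrow A)
  label : ℕ → Word A

namespace Aut

variable {A : Type*} [LinearOrder A]

/-- The automaton with the single state `0` and without arrows. -/
def trivial : Aut A := ⟨∅, ∅, fun _ => []⟩

/-- `s` is a state. -/
def IsState (M : Aut A) (s : ℕ) : Prop := s = 0 ∨ ∃ e ∈ M.arrows, e.1 = s ∨ e.2.2 = s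

/-- The set of rules `L(M) ∩ L(SL2)`. -/
def rules (M : Aut A) : Set (Rule A) :=
  {r | TracePath M.arrows 0 (pad r.1 r.2) 0 ∧ SL2 r}

/-- A word is `Aut`-reducible if it contains the left-hand side of a rule in `L(M) ∩ L(SL2)`. -/
def Reducible (M : Aut A) (w : Word A) : Prop := ∃ r ∈ M.rules, r.1 <:+: w

/-- Some proper subword of `w` is `Aut`-reducible. -/
def ProperReducible (M : Aut A) (w : Word A) : Prop := ∃ u, u <:+: w ∧ u ≠ w ∧ M.Reducible u

/-- The least equivalence relation on states that contains the identifications `I`, whose quotient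
and the reversal of whose quotient are partially deterministic, and such that every arrow of the
quotient labelled `(x, x)` with source or target the initial state is a loop. -/
inductive WeldRel (E : Finset (Arrow A)) (I : ℕ → ℕ → Prop) : ℕ → ℕ → Prop
  | ident {s t : ℕ} : I s t → WeldRel E I s t
  | refl (s : ℕ) : WeldRel E I s s
  | symm {s t : ℕ} : WeldRel E I s t → WeldRel E I t s
  | trans {s t r : ℕ} : WeldRel E I s t → WeldRel E I t r → WeldRel E I s r
  | target {s t s' t' : ℕ} {a : Label A} : (s, a, t) ∈ E → (s', a, t') ∈ E →
      WeldRel E I s s' → WeldRel E I t t'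
  | source {s t s' t' : ℕ} {a : Label A} : (s, a, t) ∈ E → (s', a, t') ∈ E →
      WeldRel E I t t' → WeldRel E I s s'
  | diagTarget {s t : ℕ} {x : A} : (s, (some x, some x), t) ∈ E →
      WeldRel E I 0 s → WeldRel E I 0 t
  | diagSource {s t : ℕ} {x : A} : (s, (some x, some x), t) ∈ E →
      WeldRel E I 0 t → WeldRel E I 0 s

/-- The least state identified with `s` during welding. -/
noncomputable def weldRep (E : Finset (Arrow A)) (I : ℕ → ℕ → Prop) (s : ℕ) : ℕ :=
  sInf {t | WeldRel E I s t}

/-- The images of the arrows in `F` in the welded quotient of `E`, without the loops at the initial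
state that are labelled `(x, x)`. -/
noncomputable def weldArrows (E : Finset (Arrow A)) (I : ℕ → ℕ → Prop) (F : Finset (Arrow A)) :
    Finset (Arrow A) :=
  (F.image fun e => (weldRep E I e.1, e.2.1, weldRep E I e.2.2)).filter
    fun e => ¬ ((e.1 = 0 ∨ e.2.2 = 0) ∧ e.2.1.1 = e.2.1.2)

/-- The result of identifying the states related by `I` and welding. The image of a needed arrow is
needed. A class of states keeps the word attached to its least element. -/
noncomputable def weld (M : Aut A) (I : ℕ → ℕ → Prop) : Aut A where
  arrows := weldArrows M.arrows I M.arrows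
  needed := weldArrows M.arrows I M.needed
  label := M.label

/-- The arrows of a path labelled by the given list from the state `s` to the state `0`, whose
intermediate states are `n`, `n + 1`, …. -/
def pathArrows : List (Label A) → ℕ → ℕ → Finset (Arrow A)
  | [], _, _ => ∅
  | [a], s, _ => {(s, a, 0)}
  | a :: b :: l, s, n => insert (s, a, n) (pathArrows (b :: l) n (n + 1))

/-- A number such that it and all greater numbers are not states. -/
def fresh (M : Aut A) : ℕ := (M.arrows.sup fun e => max e.1 e.2.2) + 1

/-- Incorporate the pair `r = (u₁ u₂ …, v₁ v₂ …)` into the language of `M` by welding, and mark the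
corresponding arrows as needed. The new state reached after reading the first `i` letters of
`(u, v)⁺` gets the word `(u₁ … uᵢ)⁻¹ v₁ … vᵢ`. -/
noncomputable def adjoin (inv : A → A) (M : Aut A) (r : Rule A) : Aut A :=
  weld
    { arrows := M.arrows ∪ pathArrows (pad r.1 r.2) 0 M.fresh
      needed := M.needed ∪ pathArrows (pad r.1 r.2) 0 M.fresh
      label := fun s =>
        if s < M.fresh then M.label s
        else invWord inv (r.1.take (s - M.fresh + 1)) ++ r.2.take (s - M.fresh + 1) }
    (fun _ _ => False)

/-- Delete the arrows (and states) that are not marked as needed. -/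
def prune (M : Aut A) : Aut A := { M with arrows := M.arrows ∩ M.needed }

/-- Mark all arrows (and states) as not needed. -/
def unmark (M : Aut A) : Aut A := { M with needed := ∅ }

/-- Replace the word attached to the state `s` by `w`. -/
def relabel (M : Aut A) (s : ℕ) (w : Word A) : Aut A :=
  { M with label := Function.update M.label s w }

/-- Two states carry the same word. -/
def SameLabel (M : Aut A) (s t : ℕ) : Prop := M.IsState s ∧ M.IsState t ∧ M.label s = M.label t

end Aut

/-! ## The store of rules and `Aut`-reduction -/

/-- The finite set `S` of rules, which is kept in four parts. -/
@[ext]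
structure Store (A : Type*) where
  considered : Finset (Rule A)
  now : Finset (Rule A)
  new : Finset (Rule A)
  delete : Finset (Rule A)

namespace Store

variable {A : Type*} [LinearOrder A]

/-- All the rules in `S`. -/
def all (S : Store A) : Finset (Rule A) := S.considered ∪ S.now ∪ S.new ∪ S.delete

/-- The rules in `S` that are not in the part `delete`. -/
def active (S : Store A) : Finset (Rule A) := S.all \ S.delete

/-- Insert a rule into `new`, unless it is already in `S`. -/
def insertNew (S : Store A) (r : Rule A) : Store A :=
  if r ∈ S.all then S else { S with new := insert r S.new }

/-- Insert an output of minimization into `now`, unless it is already in `now` or `considered`, and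
remove it from `new`. -/
def install (S : Store A) (r : Rule A) : Store A :=
  { S with
    now := if r ∈ S.now ∨ r ∈ S.considered then S.now else insert r S.now
    new := S.new.erase r }

/-- Delete a rule from `S` altogether. -/
def remove (S : Store A) (r : Rule A) : Store A :=
  ⟨S.considered.erase r, S.now.erase r, S.new.erase r, S.delete.erase r⟩

/-- Move a rule to the part `delete`. -/
def moveToDelete (S : Store A) (r : Rule A) : Store A :=
  ⟨S.considered.erase r, S.now.erase r, S.new.erase r, insert r S.delete⟩

/-- Move a rule from `now` to `considered`. -/
def moveToConsidered (S : Store A) (r : Rule A) : Store A :=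
  { S with now := S.now.erase r, considered := insert r S.considered }

/-- Delete the rules in `delete`. -/
def emptyDelete (S : Store A) : Store A := { S with delete := ∅ }

end Store

section Reduction

variable {A : Type*} [LinearOrder A]

/-- `lam → rho` is the least rule with left-hand side `lam` in `R`. -/
def LeastRule (R : Set (Rule A)) (lam rho : Word A) : Prop :=
  (lam, rho) ∈ R ∧ ∀ rho', (lam, rho') ∈ R → Le rho rho'

/-- One step of `Aut`-reduction with respect to `M`, from the word `w` to the word `w'`, while the
store changes from `S` to `S'`. Find a subword `lam` of `w` that is reducible and all of whose
proper subwords are irreducible. If `S` has rules with left-hand side `lam`, use the least of them.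
Otherwise, use the least such rule in `L(M) ∩ L(SL2)` and insert it into `S`. -/
def AutStep (M : Aut A) (S : Store A) (w : Word A) (S' : Store A) (w' : Word A) : Prop :=
  ∃ p lam q rho, w = p ++ lam ++ q ∧ M.Reducible lam ∧ ¬ M.ProperReducible lam ∧
    w' = p ++ rho ++ q ∧
    ((LeastRule (S.all : Set (Rule A)) lam rho ∧ S' = S) ∨
      ((∀ rho', (lam, rho') ∉ S.all) ∧ LeastRule M.rules lam rho ∧
        S' = S.insertNew (lam, rho)))

/-- The two words obtained from the overlaps in which a non-trivial suffix `z` of the left-hand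
side of `r` is a prefix of the left-hand side of `r'`: if the left-hand sides are `a z` and `z b`,
then `a z b` is rewritten in two ways. -/
def overlapPairs (r r' : Rule A) : Finset (Word A × Word A) :=
  ((Finset.Icc 1 (min r.1.length r'.1.length)).filter
      fun k => r.1.drop (r.1.length - k) = r'.1.take k).image
    fun k => (r.2 ++ r'.1.drop k, r.1.take (r.1.length - k) ++ r'.2)

end Reduction

/-! ## The minimization routine -/

/-- The steps of the minimization routine that follow the reduction of the right-hand side. -/
inductive TidyStage
  | interchange
  | shiftLast
  | shiftFirst
  | cancelFirst
  | cancelLast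

/-- The stage that follows a given stage; `none` if there is none. -/
def TidyStage.next : TidyStage → Option TidyStage
  | .interchange => some .shiftLast
  | .shiftLast => some .shiftFirst
  | .shiftFirst => some .cancelFirst
  | .cancelFirst => some .cancelLast
  | .cancelLast => none

section Minimization

variable {A : Type*} [LinearOrder A]

/-- The condition for moving the last letter of `u` to the right-hand side of `(u, v)`; here
`p = |u|` and `q = |v|`: either `p > q + 2`, or `p = q + 2`, `q > 0` and `u₁ > v₁`, or `p = 2`,
`q = 0` and `u₁ > u₂⁻¹`. -/
def ShiftLastCond (inv : A → A) (u v : Word A) : Prop :=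
  v.length + 2 < u.length ∨
    (u.length = v.length + 2 ∧ ∃ a b u' v', u = a :: u' ∧ v = b :: v' ∧ b < a) ∨
    (v = [] ∧ ∃ a b, u = [a, b] ∧ inv b < a)

/-- The modifications of a pair `(u, v)` that are made in the respective stages. -/
inductive TidyMove (inv : A → A) : TidyStage → Rule A → Rule A → Prop
  | interchange {u v : Word A} : Lt u v → TidyMove inv .interchange (u, v) (v, u)
  | shiftLast {u v : Word A} {x : A} : ShiftLastCond inv (u ++ [x]) v →
      TidyMove inv .shiftLast (u ++ [x], v) (u, v ++ [inv x])
  | shiftFirst {u v : Word A} {x y : A} : (x :: y :: u).length = v.length + 2 → inv x < y →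
      TidyMove inv .shiftFirst (x :: y :: u, v) (y :: u, inv x :: v)
  | cancelFirst {u v : Word A} {x : A} : TidyMove inv .cancelFirst (x :: u, x :: v) (u, v)
  | cancelLast {u v : Word A} {x : A} :
      TidyMove inv .cancelLast (u ++ [x], v ++ [x]) (u, v)

end Minimization

/-- Local states of the minimization routine. -/
inductive MinState (A : Type*)
  /-- Reducing the maximal proper prefix `p`; the last letter of the left-hand side is `x`. -/
  | front (p : Word A) (x : A)
  /-- Reducing the maximal proper suffix `q`; the first letter of the left-hand side is `x`. -/
  | back (x : A) (q : Word A)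
  /-- Reducing the left-hand side `u`. -/
  | left (u : Word A)
  /-- Reducing the right-hand side `v` of `(u, v)`. -/
  | right (u v : Word A)
  /-- The later stages; `old` is the pair immediately after the last reduction of the right-hand
  side, `cur` is the current pair. -/
  | tidy (stage : TidyStage) (old cur : Rule A)

/-! ## The Knuth–Bendix procedure -/

/-- Where minimization of a rule was called: from the loop over `considered`, with a set of rules
of `considered` that still have to be treated, or from the loop over `new`. -/
inductive Caller (A : Type*)
  | considered (todo : Finset (Rule A))
  | new

/-- Control states of the procedure. -/
inductive Ctrl (A : Type*)
  /-- The beginning of a pass. -/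
  | start
  /-- In one of the two loops that minimize rules. -/
  | loop (k : Caller A)
  /-- Minimizing the rule `r`. -/
  | minimize (k : Caller A) (r : Rule A) (m : MinState A)
  /-- Minimization of `r` gave `out`: weld `out` into the automaton. -/
  | incorporate (k : Caller A) (r out : Rule A)
  /-- Insert `out` into `now`. -/
  | install (k : Caller A) (r out : Rule A)
  /-- Reduce the words attached to the states of the automaton. -/
  | relabel (k : Caller A) (r out : Rule A)
  /-- Decide what happens to the rule `r`. -/
  | dispose (k : Caller A) (r out : Rule A)
  /-- In the loop over `now`. -/
  | processNow
  /-- Comparing `r` with the rules of `considered`; those in `todo` still have to be treated. -/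
  | compare (r : Rule A) (todo : Finset (Rule A))
  /-- Treating the pairs of words obtained from overlaps. -/
  | overlaps (r : Rule A) (todo : Finset (Rule A)) (pairs : Finset (Word A × Word A))
  /-- Reducing the two words of such a pair. -/
  | critical (r : Rule A) (todo : Finset (Rule A)) (pairs : Finset (Word A × Word A))
      (a b : Word A)
  /-- Delete what is not needed from the automaton. -/
  | prune
  /-- Reduce the words attached to states, and identify states with the same word. -/
  | normalize
  /-- Delete the rules in `delete`. -/
  | emptyDelete

/-- A configuration of the procedure: the set `S` of rules, the automaton `Rules[n]` of the current
pass, the automaton `WDiff`, and the control state. -/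
structure Config (A : Type*) where
  store : Store A
  rulesAut : Aut A
  wdiff : Aut A
  ctrl : Ctrl A

section Procedure

variable {A : Type*} [LinearOrder A]

/-- One elementary step of the procedure. -/
inductive Step (inv : A → A) : Config A → Config A → Prop
  -- The beginning of a pass, and the loop over `considered`.
  | start {S R W} :
      Step inv ⟨S, R, W, .start⟩ ⟨S, R, W, .loop (.considered S.considered)⟩
  | consideredCall {S R W todo p x v} : (p ++ [x], v) ∈ todo →
      Step inv ⟨S, R, W, .loop (.considered todo)⟩
        ⟨S, R, W, .minimize (.considered (todo.erase (p ++ [x], v))) (p ++ [x], v) (.front p x)⟩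
  | consideredEnd {S R W} :
      Step inv ⟨S, R, W, .loop (.considered ∅)⟩ ⟨S, R, W, .loop .new⟩
  -- The loop over `new`.
  | newCall {S R W p x v} : (p ++ [x], v) ∈ S.new →
      Step inv ⟨S, R, W, .loop .new⟩ ⟨S, R, W, .minimize .new (p ++ [x], v) (.front p x)⟩
  | newEnd {S R W} : S.new = ∅ →
      Step inv ⟨S, R, W, .loop .new⟩ ⟨S, R, W, .processNow⟩
  -- The minimization routine: reduction of the maximal proper prefix.
  | frontReduce {S R W k r p x S' p'} : AutStep R S p S' p' →
      Step inv ⟨S, R, W, .minimize k r (.front p x)⟩ ⟨S', R, W, .minimize k r (.front p' x)⟩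
  | frontChanged {S R W k r p x} : ¬ R.Reducible p → p ++ [x] ≠ r.1 →
      Step inv ⟨S, R, W, .minimize k r (.front p x)⟩
        ⟨S, R, W, .minimize k r (.left (p ++ [x]))⟩
  | frontUnchanged {S R W k r p x y q} : ¬ R.Reducible p → p ++ [x] = r.1 → r.1 = y :: q →
      Step inv ⟨S, R, W, .minimize k r (.front p x)⟩ ⟨S, R, W, .minimize k r (.back y q)⟩
  -- Reduction of the maximal proper suffix.
  | backReduce {S R W k r y q S' q'} : AutStep R S q S' q' →
      Step inv ⟨S, R, W, .minimize k r (.back y q)⟩ ⟨S', R, W, .minimize k r (.back y q')⟩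
  | backChanged {S R W k r y q} : ¬ R.Reducible q → y :: q ≠ r.1 →
      Step inv ⟨S, R, W, .minimize k r (.back y q)⟩ ⟨S, R, W, .minimize k r (.left (y :: q))⟩
  | backUnchanged {S R W k r y q} : ¬ R.Reducible q → y :: q = r.1 →
      Step inv ⟨S, R, W, .minimize k r (.back y q)⟩ ⟨S, R, W, .minimize k r (.right r.1 r.2)⟩
  -- Reduction of the left-hand side.
  | leftReduce {S R W k r u S' u'} : AutStep R S u S' u' →
      Step inv ⟨S, R, W, .minimize k r (.left u)⟩ ⟨S', R, W, .minimize k r (.left u')⟩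
  | leftEnd {S R W k r u} : ¬ R.Reducible u →
      Step inv ⟨S, R, W, .minimize k r (.left u)⟩ ⟨S, R, W, .minimize k r (.right u r.2)⟩
  -- Reduction of the right-hand side.
  | rightReduce {S R W k r u v S' v'} : AutStep R S v S' v' →
      Step inv ⟨S, R, W, .minimize k r (.right u v)⟩ ⟨S', R, W, .minimize k r (.right u v')⟩
  | rightEnd {S R W k r u v} : ¬ R.Reducible v →
      Step inv ⟨S, R, W, .minimize k r (.right u v)⟩
        ⟨S, R, W, .minimize k r (.tidy .interchange (u, v) (u, v))⟩
  -- The later stages: each is repeated until it does not apply any more.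
  | tidyMove {S R W k r i old cur cur'} : TidyMove inv i cur cur' →
      Step inv ⟨S, R, W, .minimize k r (.tidy i old cur)⟩
        ⟨S, R, W, .minimize k r (.tidy i old cur')⟩
  | tidyNext {S R W k r i j old cur} : (∀ cur', ¬ TidyMove inv i cur cur') → i.next = some j →
      Step inv ⟨S, R, W, .minimize k r (.tidy i old cur)⟩
        ⟨S, R, W, .minimize k r (.tidy j old cur)⟩
  | tidyAgain {S R W k r i old cur} : (∀ cur', ¬ TidyMove inv i cur cur') → i.next = none →
      cur ≠ old →
      Step inv ⟨S, R, W, .minimize k r (.tidy i old cur)⟩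
        ⟨S, R, W, .minimize k r (.right cur.1 cur.2)⟩
  | output {S R W k r i old cur} : (∀ cur', ¬ TidyMove inv i cur cur') → i.next = none →
      cur = old →
      Step inv ⟨S, R, W, .minimize k r (.tidy i old cur)⟩ ⟨S, R, W, .incorporate k r cur⟩
  -- Handling the output of minimization.
  | redundant {S R W k r} :
      Step inv ⟨S, R, W, .incorporate k r ([], [])⟩ ⟨S, R, W, .dispose k r ([], [])⟩
  | incorporate {S R W k r out} : out ≠ ([], []) →
      Step inv ⟨S, R, W, .incorporate k r out⟩ ⟨S, R, W.adjoin inv out, .install k r out⟩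
  | install {S R W k r out} :
      Step inv ⟨S, R, W, .install k r out⟩ ⟨S.install out, R, W, .relabel k r out⟩
  | relabelReduce {S R W k r out s S' w'} : W.IsState s → AutStep R S (W.label s) S' w' →
      Step inv ⟨S, R, W, .relabel k r out⟩ ⟨S', R, W.relabel s w', .relabel k r out⟩
  | relabelEnd {S R W k r out} : (∀ s, W.IsState s → ¬ R.Reducible (W.label s)) →
      Step inv ⟨S, R, W, .relabel k r out⟩ ⟨S, R, W, .dispose k r out⟩
  | deleteNow {S R W k r out} : R.ProperReducible r.1 →
      Step inv ⟨S, R, W, .dispose k r out⟩ ⟨S.remove r, R, W, .loop k⟩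
  | deleteLater {S R W k r out} : ¬ R.ProperReducible r.1 → out ≠ r →
      Step inv ⟨S, R, W, .dispose k r out⟩ ⟨S.moveToDelete r, R, W, .loop k⟩
  | keep {S R W k r out} : ¬ R.ProperReducible r.1 → out = r →
      Step inv ⟨S, R, W, .dispose k r out⟩ ⟨S, R, W, .loop k⟩
  -- The loop over `now`: critical pair analysis.
  | processNow {S R W r} : r ∈ S.now →
      Step inv ⟨S, R, W, .processNow⟩
        ⟨S.moveToConsidered r, R, W, .compare r (S.moveToConsidered r).considered⟩
  | processNowEnd {S R W} : S.now = ∅ →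
      Step inv ⟨S, R, W, .processNow⟩ ⟨S, R, W, .prune⟩
  | compare {S R W r todo r'} : r' ∈ todo →
      Step inv ⟨S, R, W, .compare r todo⟩
        ⟨S, R, W, .overlaps r (todo.erase r') (overlapPairs r r' ∪ overlapPairs r' r)⟩
  | compareEnd {S R W r} :
      Step inv ⟨S, R, W, .compare r ∅⟩ ⟨S, R, W, .processNow⟩
  | overlaps {S R W r todo pairs a b} : (a, b) ∈ pairs →
      Step inv ⟨S, R, W, .overlaps r todo pairs⟩
        ⟨S, R, W, .critical r todo (pairs.erase (a, b)) a b⟩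
  | overlapsEnd {S R W r todo} :
      Step inv ⟨S, R, W, .overlaps r todo ∅⟩ ⟨S, R, W, .compare r todo⟩
  | criticalLeft {S R W r todo pairs a b S' a'} : AutStep R S a S' a' →
      Step inv ⟨S, R, W, .critical r todo pairs a b⟩ ⟨S', R, W, .critical r todo pairs a' b⟩
  | criticalRight {S R W r todo pairs a b S' b'} : AutStep R S b S' b' →
      Step inv ⟨S, R, W, .critical r todo pairs a b⟩ ⟨S', R, W, .critical r todo pairs a b'⟩
  | criticalGt {S R W r todo pairs a b} : ¬ R.Reducible a → ¬ R.Reducible b → Lt b a →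
      Step inv ⟨S, R, W, .critical r todo pairs a b⟩
        ⟨S.insertNew (a, b), R, W, .overlaps r todo pairs⟩
  | criticalLt {S R W r todo pairs a b} : ¬ R.Reducible a → ¬ R.Reducible b → Lt a b →
      Step inv ⟨S, R, W, .critical r todo pairs a b⟩
        ⟨S.insertNew (b, a), R, W, .overlaps r todo pairs⟩
  | criticalEq {S R W r todo pairs a} : ¬ R.Reducible a →
      Step inv ⟨S, R, W, .critical r todo pairs a a⟩ ⟨S, R, W, .overlaps r todo pairs⟩
  -- The end of a pass: the automaton `WDiff` becomes the automaton `Rules` of the next pass.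
  | prune {S R W} :
      Step inv ⟨S, R, W, .prune⟩ ⟨S, R, W.prune, .normalize⟩
  | normalizeReduce {S R W s S' w'} : W.IsState s → AutStep W S (W.label s) S' w' →
      Step inv ⟨S, R, W, .normalize⟩ ⟨S', R, W.relabel s w', .normalize⟩
  | normalizeWeld {S R W} : (∀ s, W.IsState s → ¬ W.Reducible (W.label s)) →
      (∃ s t, s ≠ t ∧ W.SameLabel s t) →
      Step inv ⟨S, R, W, .normalize⟩ ⟨S, R, W.weld W.SameLabel, .normalize⟩
  | normalizeEnd {S R W} : (∀ s, W.IsState s → ¬ W.Reducible (W.label s)) →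
      (¬ ∃ s t, s ≠ t ∧ W.SameLabel s t) →
      Step inv ⟨S, R, W, .normalize⟩ ⟨S, W.unmark, W.unmark, .emptyDelete⟩
  | emptyDelete {S R W} :
      Step inv ⟨S, R, W, .emptyDelete⟩ ⟨S.emptyDelete, R, W, .start⟩

/-- The initial set of rules: the given rules `D`, which come from the defining relators, and the
special rules `(x x⁻¹, ε)`. -/
def initialRules [Fintype A] (inv : A → A) (D : Finset (Rule A)) : Finset (Rule A) :=
  D ∪ Finset.univ.image fun x => ([x, inv x], [])

/-- Initial configurations: all initial rules are in `new`, and both automata are obtained by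
welding the initial rules together (in some order), everything being marked as needed. -/
def IsInitial [Fintype A] (inv : A → A) (D : Finset (Rule A)) (c : Config A) : Prop :=
  c.store = ⟨∅, ∅, initialRules inv D, ∅⟩ ∧
    (∃ l : List (Rule A), l.Nodup ∧ l.toFinset = initialRules inv D ∧
      c.wdiff = l.foldl (Aut.adjoin inv) Aut.trivial) ∧
    c.rulesAut = c.wdiff ∧ c.ctrl = .start

/-- `c 0, c 1, …, c N` are the configurations at the times `0, 1, …, N` of an execution of the
procedure, started from the rules `D`. -/
def IsRun [Fintype A] (inv : A → A) (D : Finset (Rule A)) (c : ℕ → Config A) (N : ℕ) : Prop :=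
  IsInitial inv D (c 0) ∧ ∀ n < N, Step inv (c n) (c (n + 1))

end Procedure

/-! ## Thue paths -/

section ThuePaths

variable {A : Type*} [LinearOrder A]

/-- `v` is obtained from `u` by an elementary reduction with a rule in `R`. -/
def ElemRed (R : Set (Rule A)) (u v : Word A) : Prop :=
  ∃ s₁ s₂ lam rho, (lam, rho) ∈ R ∧ u = s₁ ++ lam ++ s₂ ∧ v = s₁ ++ rho ++ s₂

/-- `IsPath R u v l`: there is a finite sequence of elementary reductions with rules in `R`, and
inverses of such reductions, that connects `u` to `v`, and `l` is the list of its nodes. (The node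
of the empty path from `u` to `u` is `u`.) -/
inductive IsPath (R : Set (Rule A)) : Word A → Word A → List (Word A) → Prop
  | nil (u : Word A) : IsPath R u u [u]
  | rightward {u u' v : Word A} {l : List (Word A)} :
      ElemRed R u u' → IsPath R u' v l → IsPath R u v (u :: l)
  | leftward {u u' v : Word A} {l : List (Word A)} :
      ElemRed R u' u → IsPath R u' v l → IsPath R u v (u :: l)

/-- A Thue path in the configuration `c` from `u` to `v` with list of nodes `l`: the rules that it
uses are in `S`, but not in the part `delete`. -/
def ThuePath (c : Config A) (u v : Word A) (l : List (Word A)) : Prop :=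
  IsPath (c.store.active : Set (Rule A)) u v l

/-- `w` is the maximal element of `l` in the short-lex order. -/
def IsMaxNode (l : List (Word A)) (w : Word A) : Prop := w ∈ l ∧ ∀ x ∈ l, Le x w

end ThuePaths

end KB

/-! Adding a rule only adds Thue paths, so the danger lies in rules that leave the active part of
the store. The claim is that whenever a rule `r` leaves it, its two sides are already joined by
active rules strictly less than `r` (left-hand sides compared first, then right-hand sides), through
words not exceeding the left-hand side. As `r` is not less than itself, this path survives the
removal. Substituting it, in context, for each use of `r` in a Thue path never raises the maximal
node.

The invariant `Sound` says that every stored rule has such a bounded derivation from active rules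
not exceeding it. Rules in the part `delete` are included, because `Aut`-reduction may still use
them, and the cancellations needed for moving letters in minimization must be available too.
`Extends` compares stores: every active rule of the first is derivable in the second. It is
transitive, and `Step.invariant` shows that each elementary step preserves the invariant and extends
the store.

The substance is minimization. From `r` it computes `out`, and the property `Reaches` runs
backwards: once the current pair is joined by rules less than `r`, so are the sides of `r`. Every
reduction or cancellation on the way is bounded by a word less than the left-hand side of `r`, so it
can only use rules less than `r`; in particular `r` is not used to justify its own removal. If `out`
differs from `r`, it is less than `r`, or both its sides are empty, and `Reaches` yields the
required path (`OutInv.install`, `OutInv.redundant`). If `out = r` with irreducible proper subwords,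
the rule is kept.

Group theory and the language of the automata play hardly any role. All that matters is that
extracted rules are decreasing and that `Rules` stays fixed while a rule is minimized and handled.
-/

namespace KB

/-! ### Short-lex order on words and the induced order on rules. -/

section Order

variable {A : Type*} [LinearOrder A]

theorem lt_iff {u v : Word A} :
    Lt u v ↔ u.length < v.length ∨ u.length = v.length ∧ List.Lex (· < ·) u v :=
  List.shortlex_def

theorem Lt.of_length {u v : Word A} (h : u.length < v.length) : Lt u v :=
  List.Shortlex.of_length_lt h

theorem Lt.trans {u v w : Word A} (h : Lt u v) (h' : Lt v w) : Lt u w := by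
  rw [lt_iff] at *
  rcases h with h | ⟨h, hl⟩ <;> rcases h' with h' | ⟨h', hl'⟩
  · left; omega
  · left; omega
  · left; omega
  · exact Or.inr ⟨h.trans h', lt_trans (α := List A) hl hl'⟩

theorem Lt.irrefl (u : Word A) : ¬ Lt u u := fun h => asymm_of (List.Shortlex (· < ·)) h h

theorem lt_trichotomy (u v : Word A) : Lt u v ∨ u = v ∨ Lt v u :=
  trichotomous_of (List.Shortlex (· < ·)) u v

theorem Le.refl (u : Word A) : Le u u := Or.inr rfl

theorem Lt.le {u v : Word A} (h : Lt u v) : Le u v := Or.inl h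

theorem Le.trans_lt {u v w : Word A} (h : Le u v) (h' : Lt v w) : Lt u w := by
  rcases h with h | rfl
  exacts [h.trans h', h']

theorem Lt.trans_le {u v w : Word A} (h : Lt u v) (h' : Le v w) : Lt u w := by
  rcases h' with h' | rfl
  exacts [h.trans h', h]

theorem Le.trans {u v w : Word A} (h : Le u v) (h' : Le v w) : Le u w := by
  rcases h' with h' | rfl
  exacts [(h.trans_lt h').le, h]

theorem le_of_not_lt {u v : Word A} (h : ¬ Lt u v) : Le v u := by
  rcases lt_trichotomy u v with h' | rfl | h'
  exacts [absurd h' h, Le.refl _, h'.le]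

theorem le_total (u v : Word A) : Le u v ∨ Le v u := by
  rcases lt_trichotomy u v with h | rfl | h
  exacts [Or.inl h.le, Or.inl (Le.refl _), Or.inr h.le]

/-- Equality of lengths excludes the proper-prefix case, the only one in which appending letters
could reverse the comparison. -/
theorem lex_append_of_length_eq {u v : List A} (h : List.Lex (· < ·) u v)
    (hl : u.length = v.length) (p q : List A) : List.Lex (· < ·) (u ++ p) (v ++ q) := by
  induction h with
  | nil => simp at hl
  | rel h => exact List.Lex.rel h
  | cons _ ih => exact List.Lex.cons (ih (by simpa using hl))

theorem Lt.context {u v : Word A} (h : Lt u v) (p q : Word A) :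
    Lt (p ++ u ++ q) (p ++ v ++ q) := by
  rw [lt_iff] at *
  rcases h with h | ⟨h, hl⟩
  · left; simp; omega
  · refine Or.inr ⟨by simp [h], ?_⟩
    rw [List.append_assoc, List.append_assoc]
    exact List.Lex.append_left _ (lex_append_of_length_eq hl h q q) p

theorem Le.context {u v : Word A} (h : Le u v) (p q : Word A) :
    Le (p ++ u ++ q) (p ++ v ++ q) := by
  rcases h with h | rfl
  exacts [(h.context p q).le, Le.refl _]

theorem le_context (p u q : Word A) : Le u (p ++ u ++ q) := by
  by_cases h : p.length + q.length = 0
  · have hp : p = [] := List.eq_nil_of_length_eq_zero (by omega)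
    have hq : q = [] := List.eq_nil_of_length_eq_zero (by omega)
    subst hp hq
    simp [Le]
  · exact (Lt.of_length (by simp; omega)).le

theorem Lt.of_head_lt {x y : A} {u v : Word A} (h : u.length = v.length) (hxy : x < y) :
    Lt (x :: u) (y :: v) :=
  lt_iff.2 (Or.inr ⟨by simp [h], List.Lex.rel hxy⟩)

/-- The lexicographic order on rules, in which the left-hand sides are compared first. -/
def RuleLt (r r' : Rule A) : Prop := Lt r.1 r'.1 ∨ r.1 = r'.1 ∧ Lt r.2 r'.2

/-- The reflexive closure of `RuleLt`. -/
def RuleLe (r r' : Rule A) : Prop := RuleLt r r' ∨ r = r'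

theorem RuleLt.irrefl (r : Rule A) : ¬ RuleLt r r := by
  rintro (h | ⟨-, h⟩) <;> exact Lt.irrefl _ h

theorem RuleLt.trans {r r' r'' : Rule A} (h : RuleLt r r') (h' : RuleLt r' r'') :
    RuleLt r r'' := by
  rcases h with h | ⟨h, hr⟩ <;> rcases h' with h' | ⟨h', hr'⟩
  · exact Or.inl (h.trans h')
  · exact Or.inl (h' ▸ h)
  · exact Or.inl (h ▸ h')
  · exact Or.inr ⟨h.trans h', hr.trans hr'⟩

theorem RuleLe.trans_lt {r r' r'' : Rule A} (h : RuleLe r r') (h' : RuleLt r' r'') :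
    RuleLt r r'' := by
  rcases h with h | rfl
  exacts [h.trans h', h']

theorem RuleLe.trans {r r' r'' : Rule A} (h : RuleLe r r') (h' : RuleLe r' r'') :
    RuleLe r r'' := by
  rcases h' with h' | rfl
  exacts [Or.inl (h.trans_lt h'), h]

end Order

/-! ### Thue paths through words below a bound. -/

section Connected

variable {A : Type*}

theorem ElemRed.mono {R R' : Set (Rule A)} (h : R ⊆ R') {u v : Word A} (huv : ElemRed R u v) :
    ElemRed R' u v := by
  obtain ⟨p, q, lam, rho, hr, hu, hv⟩ := huv
  exact ⟨p, q, lam, rho, h hr, hu, hv⟩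

theorem ElemRed.context {R : Set (Rule A)} {u v : Word A} (h : ElemRed R u v) (p q : Word A) :
    ElemRed R (p ++ u ++ q) (p ++ v ++ q) := by
  obtain ⟨p', q', lam, rho, hr, rfl, rfl⟩ := h
  exact ⟨p ++ p', q' ++ q, lam, rho, hr, by simp, by simp⟩

variable [LinearOrder A]

/-- An elementary reduction with a rule in `R`, or the inverse of one, between words that do not
exceed `b`. -/
def BoundedStep (R : Set (Rule A)) (b u v : Word A) : Prop :=
  Le u b ∧ Le v b ∧ (ElemRed R u v ∨ ElemRed R v u)

/-- `u` and `v` are equal or connected by elementary reductions with rules in `R`, and inverses of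
such, through words that do not exceed `b`. -/
def Conn (R : Set (Rule A)) (b : Word A) : Word A → Word A → Prop :=
  Relation.ReflTransGen (BoundedStep R b)

/-- `u` and `v` are connected through words that do not exceed the greater one of them. -/
def PairConn (R : Set (Rule A)) (u v : Word A) : Prop :=
  ∀ b, Le u b → Le v b → Conn R b u v

variable {R R' : Set (Rule A)} {b b' u v w : Word A}

theorem BoundedStep.symm (h : BoundedStep R b u v) : BoundedStep R b v u :=
  ⟨h.2.1, h.1, h.2.2.symm⟩

theorem Conn.refl (u : Word A) : Conn R b u u := Relation.ReflTransGen.refl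

theorem Conn.symm (h : Conn R b u v) : Conn R b v u :=
  (@Relation.ReflTransGen.stdSymm _ _ ⟨fun _ _ => BoundedStep.symm⟩).symm _ _ h

theorem Conn.trans (h : Conn R b u v) (h' : Conn R b v w) : Conn R b u w :=
  Relation.ReflTransGen.trans h h'

theorem Conn.mono (hR : R ⊆ R') (hb : Le b b') (h : Conn R b u v) : Conn R' b' u v :=
  Relation.ReflTransGen.mono (fun _ _ h => ⟨h.1.trans hb, h.2.1.trans hb,
    h.2.2.imp (ElemRed.mono hR) (ElemRed.mono hR)⟩) _ _ h

theorem Conn.context (h : Conn R b u v) (p q : Word A) :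
    Conn R (p ++ b ++ q) (p ++ u ++ q) (p ++ v ++ q) :=
  Relation.ReflTransGen.lift (fun x => p ++ x ++ q) (fun _ _ h => ⟨h.1.context p q,
    h.2.1.context p q, h.2.2.imp (fun h => h.context p q) (fun h => h.context p q)⟩) _ _ h

theorem Conn.of_rule {r : Rule A} (hr : r ∈ R) (h : Lt r.2 r.1) : Conn R r.1 r.1 r.2 :=
  Relation.ReflTransGen.single
    ⟨Le.refl _, h.le, Or.inl ⟨[], [], r.1, r.2, hr, by simp, by simp⟩⟩

theorem Conn.of_elemRed (hR : ∀ r ∈ R, Conn R' r.1 r.1 r.2) (h : ElemRed R u v) (hu : Le u b) :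
    Conn R' b u v := by
  obtain ⟨p, q, lam, rho, hr, rfl, rfl⟩ := h
  exact ((hR _ hr).context p q).mono subset_rfl hu

/-- Rules may be replaced by bounded paths. -/
theorem Conn.replace (hR : ∀ r ∈ R, Conn R' r.1 r.1 r.2) (h : Conn R b u v) :
    Conn R' b u v := by
  induction h with
  | refl => exact Conn.refl _
  | tail _ h ih =>
    refine ih.trans ?_
    obtain ⟨hu, hv, h | h⟩ := h
    exacts [Conn.of_elemRed hR h hu, (Conn.of_elemRed hR h hv).symm]

/-- Only rules whose left-hand side does not exceed the bound are used. -/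
theorem Conn.restrict (h : Conn R b u v) : Conn {r ∈ R | Le r.1 b} b u v := by
  refine Relation.ReflTransGen.mono ?_ _ _ h
  have key : ∀ x y, ElemRed R x y → Le x b → ElemRed {r ∈ R | Le r.1 b} x y := by
    rintro x y ⟨p, q, lam, rho, hr, rfl, rfl⟩ hx
    exact ⟨p, q, lam, rho, ⟨hr, (le_context p lam q).trans hx⟩, rfl, rfl⟩
  rintro x y ⟨hx, hy, h | h⟩
  exacts [⟨hx, hy, Or.inl (key _ _ h hx)⟩, ⟨hx, hy, Or.inr (key _ _ h hy)⟩]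

theorem Conn.pairConn (h : Conn R u u v) : PairConn R u v :=
  fun _ hu _ => h.mono subset_rfl hu

theorem PairConn.symm (h : PairConn R u v) : PairConn R v u :=
  fun b hv hu => (h b hu hv).symm

/-- The order is compatible with contexts, so the greater of the two words remains the greater one
and its context is again the optimal bound. -/
theorem PairConn.context (h : PairConn R u v) (p q : Word A) :
    PairConn R (p ++ u ++ q) (p ++ v ++ q) := by
  intro b hu hv
  rcases le_total u v with huv | huv
  · exact ((h v huv (Le.refl _)).context p q).mono subset_rfl hv
  · exact ((h u (Le.refl _) huv).context p q).mono subset_rfl hu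

/-- The condition on the middle word keeps it below any bound for the outer words; without it,
concatenation could raise the maximal node. -/
theorem PairConn.trans_left (h : PairConn R u v) (hv : Le v u) (h' : PairConn R v w) :
    PairConn R u w :=
  fun b hu hw => (h b hu (hv.trans hu)).trans (h' b (hv.trans hu) hw)

theorem IsPath.conn {l : List (Word A)} (h : IsPath R u v l) (hl : ∀ x ∈ l, Le x b) :
    Conn R b u v ∧ Le u b := by
  induction h with
  | nil u => exact ⟨Conn.refl _, hl _ (by simp)⟩
  | rightward h _ ih =>
    have ih := ih fun x hx => hl x (List.mem_cons_of_mem _ hx)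
    have hu := hl _ List.mem_cons_self
    exact ⟨Relation.ReflTransGen.head ⟨hu, ih.2, Or.inl h⟩ ih.1, hu⟩
  | leftward h _ ih =>
    have ih := ih fun x hx => hl x (List.mem_cons_of_mem _ hx)
    have hu := hl _ List.mem_cons_self
    exact ⟨Relation.ReflTransGen.head ⟨hu, ih.2, Or.inr h⟩ ih.1, hu⟩

/-- The bound on `v` is a separate hypothesis because an empty connection imposes none, whereas the
empty path has a node. -/
theorem Conn.exists_isPath (h : Conn R b u v) (hv : Le v b) :
    ∃ l, IsPath R u v l ∧ ∀ x ∈ l, Le x b := by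
  induction h using Relation.ReflTransGen.head_induction_on with
  | refl => exact ⟨[v], IsPath.nil v, by simpa using hv⟩
  | @head x y hxy _ ih =>
    obtain ⟨l, hl, hb⟩ := ih
    have hx : ∀ z ∈ x :: l, Le z b := by
      intro z hz
      rcases List.mem_cons.1 hz with rfl | hz
      exacts [hxy.1, hb z hz]
    rcases hxy.2.2 with h | h
    exacts [⟨_, IsPath.rightward h hl, hx⟩, ⟨_, IsPath.leftward h hl, hx⟩]

end Connected

/-! ### Soundness of the store of rules under insertion and removal. -/

section Stores

variable {A : Type*} [LinearOrder A]

/-- The active rules that are less than `r`. -/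
def rulesBelow (S : Store A) (r : Rule A) : Set (Rule A) := {r' | r' ∈ S.active ∧ RuleLt r' r}

/-- The two sides of `r` are connected by active rules that do not exceed `r`, through words that
do not exceed the left-hand side. -/
def Derivable (S : Store A) (r : Rule A) : Prop :=
  Conn {r' | r' ∈ S.active ∧ RuleLe r' r} r.1 r.1 r.2

/-- The invariant of the set of rules: the left-hand sides are greater than the right-hand sides,
and all the rules of `S`, also those of the part `delete`, and the rules `(x x⁻¹, ε)` can be
replaced by bounded paths. -/
structure Sound (inv : A → A) (S : Store A) : Prop where
  lt : ∀ r ∈ S.all, Lt r.2 r.1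
  derivable : ∀ r ∈ S.all, Derivable S r
  cancel : ∀ x, Conn (S.active : Set (Rule A)) [x, inv x] [x, inv x] []

/-- Every active rule of `S` is derivable in `S'`. -/
def Extends (S S' : Store A) : Prop := ∀ r ∈ S.active, Derivable S' r

theorem active_subset_all (S : Store A) : S.active ⊆ S.all := Finset.sdiff_subset

variable {inv : A → A} {S S' S'' : Store A} {r : Rule A} {b u v w : Word A}

theorem Derivable.of_mem (hr : r ∈ S.active) (h : Lt r.2 r.1) : Derivable S r :=
  Conn.of_rule (R := {r' | r' ∈ S.active ∧ RuleLe r' r}) ⟨hr, Or.inr rfl⟩ h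

theorem Derivable.conn (h : Derivable S r) : Conn (S.active : Set (Rule A)) r.1 r.1 r.2 :=
  Conn.mono (fun _ h => h.1) (Le.refl _) h

theorem Derivable.conn_below {r' : Rule A} (h : Derivable S r) (hr : RuleLt r r') :
    Conn (rulesBelow S r') r.1 r.1 r.2 :=
  Conn.mono (fun _ h => ⟨h.1, h.2.trans_lt hr⟩) (Le.refl _) h

/-- The left-hand side of a rule used on a path is a subword of a node, hence at most `b`. A path
bounded strictly below the left-hand side of `r` thus cannot use `r` or any greater rule. -/
theorem Conn.below (h : Conn (S.active : Set (Rule A)) b u v) (hb : Lt b r.1) :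
    Conn (rulesBelow S r) b u v :=
  h.restrict.mono (fun _ h => ⟨h.1, Or.inl (h.2.trans_lt hb)⟩) (Le.refl _)

/-- A rule used in the derivation of `r` is at most `r`, and so are the rules that replace it; this
keeps the restriction on rules stable under substitution. -/
theorem Extends.derivable (h : Extends S S') (hr : Derivable S r) : Derivable S' r :=
  Conn.replace (fun r' hr' => Conn.mono (fun _ h => ⟨h.1, h.2.trans hr'.2⟩) (Le.refl _)
    (h r' hr'.1)) hr

theorem Extends.trans (h : Extends S S') (h' : Extends S' S'') : Extends S S'' :=
  fun r hr => h'.derivable (h r hr)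

theorem Extends.conn (h : Extends S S') (huv : Conn (S.active : Set (Rule A)) b u v) :
    Conn (S'.active : Set (Rule A)) b u v :=
  huv.replace fun r hr => (h r hr).conn

theorem Extends.below (h : Extends S S') (huv : Conn (rulesBelow S r) b u v) :
    Conn (rulesBelow S' r) b u v :=
  huv.replace fun r hr => (h r hr.1).conn_below hr.2

theorem Sound.extends_refl (h : Sound inv S) : Extends S S :=
  fun r hr => h.derivable r (active_subset_all S hr)

/-- Addition of rules. -/
theorem Sound.grow (h : Sound inv S) (hact : S.active ⊆ S'.active)
    (hall : ∀ r ∈ S'.all, r ∈ S.all ∨ r ∈ S'.active ∧ Lt r.2 r.1) :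
    Sound inv S' ∧ Extends S S' := by
  have hext : Extends S S' := fun r hr =>
    Derivable.of_mem (hact hr) (h.lt r (active_subset_all S hr))
  refine ⟨⟨fun r hr => ?_, fun r hr => ?_, fun x => hext.conn (h.cancel x)⟩, hext⟩
  · exact (hall r hr).elim (h.lt r) (·.2)
  · exact (hall r hr).elim (fun hr => hext.derivable (h.derivable r hr))
      fun hr => Derivable.of_mem hr.1 hr.2

/-- Removal of a rule that can be replaced by a path that uses lesser rules. -/
theorem Sound.drop (h : Sound inv S) (hr : Lt r.2 r.1)
    (hconn : Conn (rulesBelow S r) r.1 r.1 r.2) (hact : ∀ r' ∈ S.active, r' ≠ r → r' ∈ S'.active)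
    (hall : ∀ r' ∈ S'.all, r' ∈ S.all ∨ r' = r) :
    Sound inv S' ∧ Extends S S' := by
  -- A rule less than `r` is not `r`, so it stays active.
  have hr' : Derivable S' r := Conn.mono (fun r' h => ⟨hact r' h.1 fun he =>
    by subst he; exact RuleLt.irrefl r' h.2, Or.inl h.2⟩) (Le.refl _) hconn
  have hext : Extends S S' := by
    intro r' h'
    by_cases he : r' = r
    · exact he ▸ hr'
    · exact Derivable.of_mem (hact r' h' he) (h.lt r' (active_subset_all S h'))
  refine ⟨⟨fun r' h' => ?_, fun r' h' => ?_, fun x => hext.conn (h.cancel x)⟩, hext⟩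
  · exact (hall r' h').elim (h.lt r') (fun he => he ▸ hr)
  · exact (hall r' h').elim (fun h' => hext.derivable (h.derivable r' h')) (fun he => he ▸ hr')

theorem Sound.insertNew (h : Sound inv S) (hr : Lt r.2 r.1) :
    Sound inv (S.insertNew r) ∧ Extends S (S.insertNew r) := by
  unfold Store.insertNew
  split_ifs with hmem
  · exact ⟨h, h.extends_refl⟩
  · apply h.grow
    · intro r' h'
      simp only [Store.active, Store.all, Finset.mem_sdiff, Finset.mem_union,
        Finset.mem_insert] at *
      tauto
    · intro r' h'
      by_cases he : r' = r
      · subst he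
        simp only [Store.active, Store.all, Finset.mem_sdiff, Finset.mem_union,
          Finset.mem_insert] at *
        tauto
      · simp only [Store.active, Store.all, Finset.mem_sdiff, Finset.mem_union,
          Finset.mem_insert] at *
        tauto

theorem mem_all_insertNew (S : Store A) (r : Rule A) : r ∈ (S.insertNew r).all := by
  unfold Store.insertNew
  split_ifs with h
  · exact h
  · simp [Store.all]

/-- Erasing `r` from `new` loses nothing: unless it lies in `delete`, and so was inactive anyway,
`r` is active in `now` or `considered`. -/
theorem Sound.install (h : Sound inv S) (hr : Lt r.2 r.1) :
    Sound inv (S.install r) ∧ Extends S (S.install r) := by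
  apply h.grow
  · intro r' h'
    simp only [Store.install, Store.active, Store.all, Finset.mem_sdiff, Finset.mem_union,
      Finset.mem_erase] at *
    split_ifs with hc <;> by_cases he : r' = r <;> simp_all <;> tauto
  · intro r' h'
    by_cases he : r' = r
    · subst he
      by_cases hd : r' ∈ S.delete
      · exact Or.inl (by simp [Store.all, hd])
      · refine Or.inr ⟨?_, hr⟩
        simp only [Store.active, Finset.mem_sdiff]
        exact ⟨h', hd⟩
    · left
      simp only [Store.install, Store.all, Finset.mem_union, Finset.mem_erase] at *
      split_ifs at h' <;> simp_all

theorem mem_all_install (S : Store A) (r : Rule A) : r ∈ (S.install r).all := by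
  simp only [Store.install, Store.all, Finset.mem_union]
  split_ifs with h <;> simp
  tauto

theorem Sound.remove (h : Sound inv S) (hr : Lt r.2 r.1)
    (hconn : Conn (rulesBelow S r) r.1 r.1 r.2) :
    Sound inv (S.remove r) ∧ Extends S (S.remove r) := by
  apply h.drop hr hconn <;> intro r' h' <;>
  simp only [Store.remove, Store.active, Store.all, Finset.mem_sdiff, Finset.mem_union,
    Finset.mem_erase] at * <;> tauto

theorem Sound.moveToDelete (h : Sound inv S) (hr : Lt r.2 r.1)
    (hconn : Conn (rulesBelow S r) r.1 r.1 r.2) :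
    Sound inv (S.moveToDelete r) ∧ Extends S (S.moveToDelete r) := by
  apply h.drop hr hconn <;> intro r' h' <;>
  simp only [Store.moveToDelete, Store.active, Store.all, Finset.mem_sdiff, Finset.mem_union,
    Finset.mem_erase, Finset.mem_insert] at * <;> tauto

theorem Sound.moveToConsidered (h : Sound inv S) (hr : r ∈ S.now) :
    Sound inv (S.moveToConsidered r) ∧ Extends S (S.moveToConsidered r) := by
  have hall : (S.moveToConsidered r).all = S.all := by
    ext r'
    by_cases he : r' = r
    · subst he; simp [Store.moveToConsidered, Store.all, hr]
    · simp [Store.moveToConsidered, Store.all, he]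
  apply h.grow
  · unfold Store.active
    rw [hall]
    rfl
  · exact fun r' h' => Or.inl (hall ▸ h')

theorem Sound.emptyDelete (h : Sound inv S) :
    Sound inv S.emptyDelete ∧ Extends S S.emptyDelete := by
  apply h.grow <;> intro r' h' <;>
  simp only [Store.emptyDelete, Store.active, Store.all, Finset.mem_sdiff, Finset.mem_union,
    Finset.notMem_empty, or_false, not_false_eq_true, and_true] at * <;> tauto

/-- The rule used may lie in `delete`; it is then simulated by its derivation. A rule taken from the
automaton is decreasing by `SL2` and belongs to the new store. -/
theorem AutStep.sound {M : Aut A} (h : AutStep M S u S' v) (hS : Sound inv S) :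
    Sound inv S' ∧ Extends S S' ∧ Lt v u ∧ Conn (S'.active : Set (Rule A)) u u v := by
  obtain ⟨p, lam, q, rho, rfl, -, -, rfl, ⟨hl, rfl⟩ | ⟨-, hl, rfl⟩⟩ := h
  · exact ⟨hS, hS.extends_refl, (hS.lt _ hl.1).context p q,
      (hS.derivable _ hl.1).conn.context p q⟩
  · have hlt : Lt rho lam := hl.1.2.2.1
    have hS' := hS.insertNew (r := (lam, rho)) hlt
    exact ⟨hS'.1, hS'.2, hlt.context p q,
      (hS'.1.derivable _ (mem_all_insertNew S (lam, rho))).conn.context p q⟩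

end Stores

end KB

namespace KB

/-! ### Minimization: recovering a rule from its output by lesser rules. -/

section Minimization

variable {A : Type*} [LinearOrder A]

theorem Aut.Reducible.mono {M : Aut A} {u w : Word A} (h : M.Reducible u) (hw : u <:+: w) :
    M.Reducible w := by
  obtain ⟨r, hr, hru⟩ := h
  exact ⟨r, hr, hru.trans hw⟩

/-- A proper subword misses the first or the last letter, so it lies in `q` or in `p`. -/
theorem not_properReducible {M : Aut A} {w p q : Word A} {x y : A} (hp : w = p ++ [x])
    (hq : w = y :: q) (hp' : ¬ M.Reducible p) (hq' : ¬ M.Reducible q) :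
    ¬ M.ProperReducible w := by
  rintro ⟨u, ⟨s, t, hst⟩, hne, hu⟩
  rcases s with _ | ⟨z, s⟩
  · rcases List.eq_nil_or_concat t with rfl | ⟨t, z, rfl⟩
    · exact hne (by simpa using hst)
    · refine hp' (hu.mono ⟨[], t, ?_⟩)
      have h := hst.trans hp
      rw [List.concat_eq_append, ← List.append_assoc] at h
      exact (List.append_inj' h rfl).1
  · refine hq' (hu.mono ⟨s, t, ?_⟩)
    have h := hst.trans hq
    simp only [List.cons_append, List.cons.injEq] at h
    exact h.2

variable {inv : A → A} {S S' S'' : Store A} {r : Rule A} {u v u' v' : Word A}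

/-- In all extensions `S'` of `S`: if `u` and `v` are connected by rules less than `r`, then so are
the two sides of `r`. -/
def Reaches (S : Store A) (r : Rule A) (u v : Word A) : Prop :=
  ∀ S', Extends S S' → PairConn (rulesBelow S' r) u v → PairConn (rulesBelow S' r) r.1 r.2

theorem Reaches.self (S : Store A) (r : Rule A) : Reaches S r r.1 r.2 := fun _ _ h => h

theorem Reaches.extend (h : Reaches S r u v) (hS : Extends S S') : Reaches S' r u v :=
  fun S'' hS'' => h S'' (hS.trans hS'')

/-- One implication about connections in later stores is composed with the previous ones. The
quantification over later stores is essential: an implication between connections in one store need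
not persist when the store changes. -/
theorem Reaches.step (h : Reaches S r u v)
    (h' : ∀ S', Extends S S' → PairConn (rulesBelow S' r) u' v' →
      PairConn (rulesBelow S' r) u v) : Reaches S r u' v' :=
  fun S' hS' hc => h S' hS' (h' S' hS' hc)

theorem Reaches.interchange (h : Reaches S r u v) : Reaches S r v u :=
  h.step fun _ _ => PairConn.symm

/-- Replacement of a subword of the left-hand side. -/
theorem Reaches.reduce_left {p q : Word A} (h : Reaches S r (p ++ u ++ q) v)
    (hc : Conn (S.active : Set (Rule A)) u u u') (hu : Lt u' u) (hur : Lt u r.1) :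
    Reaches S r (p ++ u' ++ q) v :=
  h.step fun _ hS' hc' => (((hS'.conn hc).below hur).pairConn.context p q).trans_left
    (hu.context p q).le hc'

/-- Reduction of the right-hand side. -/
theorem Reaches.reduce_right (h : Reaches S r u v)
    (hc : Conn (S.active : Set (Rule A)) v v v') (hv : Lt v' v) (hvr : Lt v r.1) :
    Reaches S r u v' :=
  h.step fun _ hS' hc' => (((hS'.conn hc).below hvr).pairConn.trans_left hv.le hc'.symm).symm

theorem shiftLastCond_length {x : A} (h : ShiftLastCond inv (u ++ [x]) v) :
    v.length + 1 ≤ u.length := by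
  rcases h with h | ⟨h, -⟩ | ⟨rfl, a, b, h, -⟩
  · simp at h; omega
  · simp at h; omega
  · have := congrArg List.length h
    simp at this ⊢; omega

/-- This is what the three alternatives of the condition have in common: undoing the move passes
through `v x⁻¹ x`, which must lie below the old left-hand side. -/
theorem shiftLastCond_lt {x : A}
    (h : ShiftLastCond inv (u ++ [x]) v) : Lt (v ++ [inv x, x]) (u ++ [x]) := by
  rcases h with h | ⟨h, a, b, u', v', hu, rfl, hab⟩ | ⟨rfl, a, b, hu, hab⟩
  · exact Lt.of_length (by simpa using h)
  · rw [hu, List.cons_append]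
    rw [hu] at h
    refine Lt.of_head_lt ?_ hab
    simp at h ⊢
    omega
  · have hux : u ++ [x] = [a] ++ [b] := hu
    obtain ⟨rfl, hx⟩ := List.append_inj' hux rfl
    obtain rfl : x = b := by simpa using hx
    exact Lt.of_head_lt rfl hab

/-- The tidying moves preserve the bound on the two words. -/
theorem TidyMove.lt {i : TidyStage} {cur cur' : Rule A} {b : Word A}
    (h : TidyMove inv i cur cur') (hu : Le cur.1 b) (hv : Lt cur.2 b) :
    Lt cur'.1 b ∧ Lt cur'.2 b := by
  rcases h with h | h | ⟨h, -⟩ | _ | _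
  · exact ⟨hv, h.trans hv⟩
  · have hl := shiftLastCond_length h
    exact ⟨(Lt.of_length (by simp)).trans_le hu, (Lt.of_length (by simp; omega)).trans_le hu⟩
  · simp only [List.length_cons] at h
    exact ⟨(Lt.of_length (by simp)).trans_le hu,
      (Lt.of_length (by simp only [List.length_cons]; omega)).trans_le hu⟩
  · exact ⟨(Lt.of_length (by simp)).trans_le hu, (Lt.of_length (by simp)).trans hv⟩
  · exact ⟨(Lt.of_length (by simp)).trans_le hu, (Lt.of_length (by simp)).trans hv⟩

/-- The maximal length serves as a potential: interchange preserves it, so a pair that returns to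
its old value has undergone no other move. -/
theorem TidyMove.maxLength_lt {i : TidyStage} {cur cur' : Rule A}
    (h : TidyMove inv i cur cur') (hi : i ≠ .interchange) :
    max cur'.1.length cur'.2.length < max cur.1.length cur.2.length := by
  rcases h with h | h | ⟨h, -⟩ | _ | _
  · exact absurd rfl hi
  · have hl := shiftLastCond_length h
    simp; omega
  · simp at h ⊢; omega
  · simp
  · simp

theorem TidyMove.maxLength_interchange {cur cur' : Rule A}
    (h : TidyMove inv .interchange cur cur') :
    max cur'.1.length cur'.2.length = max cur.1.length cur.2.length := by
  rcases h with ⟨h⟩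
  exact max_comm _ _

/-- Each move is undone by multiplying both sides by the letter that was moved or cancelled. For a
shift, a pair of inverse letters must then be removed from the right-hand side. The condition for
the shift makes that pair less than the left-hand side of `r`, so its removal uses only rules less
than `r`, even when `r` is itself a cancellation rule. -/
theorem TidyMove.reaches (hinv : Function.Involutive inv) {i : TidyStage} {cur cur' : Rule A}
    (hS : Sound inv S) (h : TidyMove inv i cur cur') (hu : Le cur.1 r.1)
    (hr : Reaches S r cur.1 cur.2) : Reaches S r cur'.1 cur'.2 := by
  rcases h with h | @⟨u, v, x, h⟩ | @⟨u, v, x, y, h, hxy⟩ | @⟨u, v, x⟩ | @⟨u, v, x⟩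
  · exact hr.interchange
  · refine hr.step fun S' hS' hc => ?_
    have hlt := shiftLastCond_lt h
    have hxx : Lt [inv x, x] r.1 := by
      have := le_context v [inv x, x] []
      rw [List.append_nil] at this
      exact (this.trans_lt hlt).trans_le hu
    have hcancel := hS'.conn (hS.cancel (inv x))
    -- The cancellation of `inv x` followed by its inverse is that of `x⁻¹ x`, since `inv` is an
    -- involution.
    rw [hinv x] at hcancel
    have h1 := (hcancel.below hxx).pairConn.context v []
    have h2 := hc.context [] [x]
    simp only [List.append_nil, List.nil_append, List.append_assoc, List.cons_append] at h1 h2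
    refine h2.trans_left hlt.le (h1.trans_left ?_ ?_)
    · have := le_context [] v [inv x, x]
      rwa [List.nil_append] at this
    · exact fun _ _ _ => Conn.refl _
  · refine hr.step fun S' hS' hc => ?_
    have hlt : Lt (x :: inv x :: v) (x :: y :: u) := by
      have := (Lt.of_head_lt (u := v) (v := u) (by simpa using h.symm) hxy).context [x] []
      simpa using this
    have hxx : Lt [x, inv x] r.1 := by
      have := le_context [] [x, inv x] v
      exact (this.trans_lt hlt).trans_le hu
    have h1 := ((hS'.conn (hS.cancel x)).below hxx).pairConn.context [] v
    have h2 := hc.context [x] []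
    simp only [List.append_nil, List.nil_append, List.cons_append] at h1 h2
    refine h2.trans_left hlt.le (h1.trans_left ?_ ?_)
    · have := le_context [x, inv x] v []
      rwa [List.append_nil] at this
    · exact fun _ _ _ => Conn.refl _
  · refine hr.step fun S' hS' hc => ?_
    have := hc.context [x] []
    simpa using this
  · refine hr.step fun S' hS' hc => ?_
    exact hc.context [] [x]

/-- The bounds on the current pair `(u, v)` during the minimization of `r`, after the reduction of
the left-hand side. -/
def Bounded (M : Aut A) (r : Rule A) (u v : Word A) : Prop :=
  u = r.1 ∧ Le v r.2 ∧ ¬ M.ProperReducible r.1 ∨ Lt u r.1 ∧ Lt v r.1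

theorem Bounded.le_left {M : Aut A} (h : Bounded M r u v) : Le u r.1 := by
  rcases h with ⟨rfl, -⟩ | h
  exacts [Le.refl _, h.1.le]

theorem Bounded.lt_right {M : Aut A} (h : Bounded M r u v) (hr : Lt r.2 r.1) : Lt v r.1 := by
  rcases h with ⟨-, h, -⟩ | h
  exacts [h.trans_lt hr, h.2]

theorem Bounded.reduce_right {M : Aut A} (h : Bounded M r u v) (hv : Lt v' v) :
    Bounded M r u v' := by
  rcases h with ⟨hu, h, hM⟩ | h
  exacts [Or.inl ⟨hu, hv.le.trans h, hM⟩, Or.inr ⟨h.1, hv.trans h.2⟩]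

/-- The invariant of the stages of minimization that follow the reduction of the right-hand
side. It guarantees that an unchanged pair has passed the first of these stages. -/
def TidyInv (i : TidyStage) (old cur : Rule A) : Prop :=
  max cur.1.length cur.2.length ≤ max old.1.length old.2.length ∧
    (i = .interchange ∨ ¬ Lt cur.1 cur.2 ∨
      max cur.1.length cur.2.length < max old.1.length old.2.length)

/-- The invariant of minimization. -/
def MinInv (M : Aut A) (S : Store A) (r : Rule A) : MinState A → Prop
  | .front p x => Le (p ++ [x]) r.1 ∧ Reaches S r (p ++ [x]) r.2
  | .back y q => Le (y :: q) r.1 ∧ (∃ p x, r.1 = p ++ [x] ∧ ¬ M.Reducible p) ∧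
      Reaches S r (y :: q) r.2
  | .left u => Lt u r.1 ∧ Reaches S r u r.2
  | .right u v => Bounded M r u v ∧ Reaches S r u v
  | .tidy i old cur => Bounded M r cur.1 cur.2 ∧ Reaches S r cur.1 cur.2 ∧ TidyInv i old cur

/-- The invariant of an output of minimization. -/
def OutInv (M : Aut A) (S : Store A) (r out : Rule A) : Prop :=
  Bounded M r out.1 out.2 ∧ Reaches S r out.1 out.2 ∧ (out = ([], []) ∨ Lt out.2 out.1)

/-- Either the rule `r` was not changed by minimization, or it can be replaced by a path that uses
lesser rules. -/
def DisposeInv (M : Aut A) (S : Store A) (r out : Rule A) : Prop :=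
  out = r ∧ ¬ M.ProperReducible r.1 ∨ Conn (rulesBelow S r) r.1 r.1 r.2

theorem TidyInv.move {i : TidyStage} {old cur cur' : Rule A} (h : TidyInv i old cur)
    (hm : TidyMove inv i cur cur') : TidyInv i old cur' := by
  by_cases hi : i = .interchange
  · subst hi
    exact ⟨hm.maxLength_interchange.trans_le h.1, Or.inl rfl⟩
  · have := (hm.maxLength_lt hi).trans_le h.1
    exact ⟨this.le, Or.inr (Or.inr this)⟩

theorem TidyInv.next {i j : TidyStage} {old cur : Rule A} (h : TidyInv i old cur)
    (hm : ∀ cur', ¬ TidyMove inv i cur cur') : TidyInv j old cur := by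
  refine ⟨h.1, Or.inr ?_⟩
  rcases h.2 with rfl | h
  · exact Or.inl fun hlt => hm _ (TidyMove.interchange (u := cur.1) (v := cur.2) hlt)
  · exact h

/-- An unchanged pair has the old maximal length, so the interchange stage has left the right-hand
side at most the left. If they were equal and non-empty, `cancelLast` would still apply. -/
theorem TidyInv.output {i : TidyStage} {cur : Rule A} (h : TidyInv i cur cur)
    (hm : ∀ cur', ¬ TidyMove inv i cur cur') (hi : i.next = none) :
    cur = ([], []) ∨ Lt cur.2 cur.1 := by
  cases i <;> try simp [TidyStage.next] at hi
  obtain ⟨u, v⟩ := cur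
  rcases h.2 with h | h | h
  · cases h
  · rcases le_of_not_lt h with h | h
    · exact Or.inr h
    · obtain rfl : v = u := h
      rcases List.eq_nil_or_concat v with rfl | ⟨w, x, rfl⟩
      · exact Or.inl rfl
      · rw [List.concat_eq_append] at hm
        exact absurd TidyMove.cancelLast (hm (w, w))
  · exact absurd h (lt_irrefl _)

theorem OutInv.redundant {M : Aut A} (h : OutInv M S r ([], [])) (hr : Lt r.2 r.1)
    (hS : Sound inv S) : DisposeInv M S r ([], []) := by
  right
  exact h.2.1 S hS.extends_refl (fun _ _ _ => Conn.refl _) _ (Le.refl _) hr.le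

/-- Outside the case of an unchanged irreducible rule, `Bounded` makes `out` less than `r`. Its
derivation then uses only rules less than `r`, even if `out` itself lies in `delete`. -/
theorem OutInv.install {M : Aut A} {out : Rule A} (h : OutInv M S r out) (hr : Lt r.2 r.1)
    (hS : Sound inv S') (hSS : Extends S S') (hout : out ∈ S'.all) : DisposeInv M S' r out := by
  by_cases he : out = r ∧ ¬ M.ProperReducible r.1
  · exact Or.inl he
  · right
    have hlt : RuleLt out r := by
      rcases h.1 with ⟨h1, h2 | h2, h3⟩ | h
      · exact Or.inr ⟨h1, h2⟩
      · exact absurd ⟨Prod.ext h1 h2, h3⟩ he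
      · exact Or.inl h.1
    exact h.2.1 S' hSS ((hS.derivable out hout).conn_below hlt).pairConn _ (Le.refl _) hr.le

theorem DisposeInv.extend {M : Aut A} {out : Rule A} (h : DisposeInv M S r out)
    (hS : Extends S S') : DisposeInv M S' r out :=
  h.imp_right hS.below

end Minimization

/-! ### Invariance under the steps of the procedure. -/

section Procedure

variable {A : Type*} [LinearOrder A]

/-- The rules that still have to be treated have greater left-hand sides. -/
def CallerInv : Caller A → Prop
  | .considered todo => ∀ r ∈ todo, Lt r.2 r.1
  | .new => True

/-- The invariant of the control state. -/
def CtrlInv (M : Aut A) (S : Store A) : Ctrl A → Prop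
  | .loop k => CallerInv k
  | .minimize k r m => CallerInv k ∧ Lt r.2 r.1 ∧ MinInv M S r m
  | .incorporate k r out => CallerInv k ∧ Lt r.2 r.1 ∧ OutInv M S r out
  | .install k r out => CallerInv k ∧ Lt r.2 r.1 ∧ OutInv M S r out ∧ out ≠ ([], [])
  | .relabel k r out => CallerInv k ∧ Lt r.2 r.1 ∧ DisposeInv M S r out
  | .dispose k r out => CallerInv k ∧ Lt r.2 r.1 ∧ DisposeInv M S r out
  | _ => True

/-- The invariant of the procedure. -/
def ConfigInv (inv : A → A) (c : Config A) : Prop :=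
  Sound inv c.store ∧ CtrlInv c.rulesAut c.store c.ctrl

variable {inv : A → A}

theorem MinInv.start (M : Aut A) (S : Store A) (p v : Word A) (x : A) :
    MinInv M S (p ++ [x], v) (.front p x) :=
  ⟨Le.refl _, Reaches.self S (p ++ [x], v)⟩

theorem Step.invariant (hinv : Function.Involutive inv) {c c' : Config A} (h : Step inv c c')
    (hc : ConfigInv inv c) : ConfigInv inv c' ∧ Extends c.store c'.store := by
  obtain ⟨hS, hI⟩ := hc
  have stay {I : Prop} (hI : I) (hS : Sound inv c.store) :
    (Sound inv c.store ∧ I) ∧ Extends c.store c.store := ⟨⟨hS, hI⟩, hS.extends_refl⟩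
  cases h with
  | start =>
    refine stay (fun r hr => hS.lt r ?_) hS
    simp [Store.all, hr]
  | consideredCall hr =>
    exact stay ⟨fun r h => hI r (Finset.mem_of_mem_erase h), hI _ hr, MinInv.start _ _ _ _ _⟩ hS
  | consideredEnd => exact stay trivial hS
  | newCall hr =>
    exact stay ⟨trivial, hS.lt _ (by simp [Store.all, hr]), MinInv.start _ _ _ _ _⟩ hS
  | newEnd => exact stay trivial hS
  | @frontReduce S R W k r p x S' p' h =>
    obtain ⟨hk, hr, hle, hreach⟩ := hI
    obtain ⟨hS', hext, hlt, hconn⟩ := h.sound hS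
    refine ⟨⟨hS', hk, hr, (hlt.context [] [x]).le.trans hle, ?_⟩, hext⟩
    -- The reduced word lacks the letter `x`, so it is strictly less than the left-hand side of `r`,
    -- and its reduction cannot depend on `r`.
    exact (hreach.extend hext).reduce_left (p := []) (q := [x]) hconn hlt
      ((Lt.of_length (by simp)).trans_le hle)
  | frontChanged _ hne =>
    obtain ⟨hk, hr, hle, hreach⟩ := hI
    exact stay ⟨hk, hr, hle.resolve_right hne, hreach⟩ hS
  | frontUnchanged hp hpx hyq =>
    obtain ⟨hk, hr, hle, hreach⟩ := hI
    refine stay ⟨hk, hr, Or.inr hyq.symm, ⟨_, _, hpx.symm, hp⟩, ?_⟩ hS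
    rw [← hyq]
    exact Reaches.self _ _
  | @backReduce S R W k r y q S' q' h =>
    obtain ⟨hk, hr, hle, hp, hreach⟩ := hI
    obtain ⟨hS', hext, hlt, hconn⟩ := h.sound hS
    have hlt' : Lt (y :: q') (y :: q) := by simpa using hlt.context [y] []
    refine ⟨⟨hS', hk, hr, hlt'.le.trans hle, hp, ?_⟩, hext⟩
    have := Reaches.reduce_left (p := [y]) (q := []) (v := r.2) (S := S') (r := r) (u := q)
      (by simpa using hreach.extend hext) hconn hlt ((Lt.of_length (by simp)).trans_le hle)
    simpa using this
  | backChanged _ hne =>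
    obtain ⟨hk, hr, hle, -, hreach⟩ := hI
    exact stay ⟨hk, hr, hle.resolve_right hne, hreach⟩ hS
  | backUnchanged hq hyq =>
    obtain ⟨hk, hr, -, ⟨p, x, hpx, hp⟩, -⟩ := hI
    -- Irreducibility of both maximal proper subwords is recorded here; it later rules out immediate
    -- deletion of an unchanged rule.
    exact stay ⟨hk, hr, Or.inl ⟨rfl, Le.refl _, not_properReducible hpx hyq.symm hp hq⟩,
      Reaches.self _ _⟩ hS
  | @leftReduce S R W k r u S' u' h =>
    obtain ⟨hk, hr, hu, hreach⟩ := hI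
    obtain ⟨hS', hext, hlt, hconn⟩ := h.sound hS
    refine ⟨⟨hS', hk, hr, hlt.trans hu, ?_⟩, hext⟩
    have := Reaches.reduce_left (p := []) (q := []) (v := r.2) (S := S') (r := r) (u := u)
      (by simpa using hreach.extend hext) hconn hlt hu
    simpa using this
  | leftEnd _ =>
    obtain ⟨hk, hr, hu, hreach⟩ := hI
    exact stay ⟨hk, hr, Or.inr ⟨hu, hr⟩, hreach⟩ hS
  | rightReduce h =>
    obtain ⟨hk, hr, hb, hreach⟩ := hI
    obtain ⟨hS', hext, hlt, hconn⟩ := h.sound hS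
    exact ⟨⟨hS', hk, hr, hb.reduce_right hlt,
      (hreach.extend hext).reduce_right hconn hlt (hb.lt_right hr)⟩, hext⟩
  | rightEnd _ =>
    obtain ⟨hk, hr, hb, hreach⟩ := hI
    exact stay ⟨hk, hr, hb, hreach, le_rfl, Or.inl rfl⟩ hS
  | tidyMove h =>
    obtain ⟨hk, hr, hb, hreach, ht⟩ := hI
    -- After any move both sides are strictly less than the old left-hand side, whichever
    -- alternative of `Bounded` held before.
    exact stay ⟨hk, hr, Or.inr (h.lt hb.le_left (hb.lt_right hr)),
      h.reaches hinv hS hb.le_left hreach, ht.move h⟩ hS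
  | tidyNext h _ =>
    obtain ⟨hk, hr, hb, hreach, ht⟩ := hI
    exact stay ⟨hk, hr, hb, hreach, ht.next h⟩ hS
  | tidyAgain _ _ _ =>
    obtain ⟨hk, hr, hb, hreach, -⟩ := hI
    exact stay ⟨hk, hr, hb, hreach⟩ hS
  | output h hi he =>
    obtain ⟨hk, hr, hb, hreach, ht⟩ := hI
    subst he
    exact stay ⟨hk, hr, hb, hreach, ht.output h hi⟩ hS
  | redundant =>
    obtain ⟨hk, hr, ho⟩ := hI
    exact stay ⟨hk, hr, ho.redundant hr hS⟩ hS
  | incorporate hne =>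
    obtain ⟨hk, hr, ho⟩ := hI
    exact stay ⟨hk, hr, ho, hne⟩ hS
  | install =>
    obtain ⟨hk, hr, ho, hne⟩ := hI
    obtain ⟨hS', hext⟩ := hS.install (ho.2.2.resolve_left hne)
    exact ⟨⟨hS', hk, hr, ho.install hr hS' hext (mem_all_install _ _)⟩, hext⟩
  | relabelReduce _ h =>
    obtain ⟨hk, hr, hd⟩ := hI
    obtain ⟨hS', hext, -⟩ := h.sound hS
    exact ⟨⟨hS', hk, hr, hd.extend hext⟩, hext⟩
  | relabelEnd _ => exact stay hI hS
  | deleteNow h =>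
    obtain ⟨hk, hr, hd⟩ := hI
    -- A reducible proper subword excludes the unchanged alternative of `DisposeInv`, leaving the
    -- path of lesser rules.
    obtain ⟨hS', hext⟩ := hS.remove hr (hd.resolve_left fun hd => hd.2 h)
    exact ⟨⟨hS', hk⟩, hext⟩
  | deleteLater _ hne =>
    obtain ⟨hk, hr, hd⟩ := hI
    obtain ⟨hS', hext⟩ := hS.moveToDelete hr (hd.resolve_left fun hd => hne hd.1)
    exact ⟨⟨hS', hk⟩, hext⟩
  | keep _ _ => exact stay hI.1 hS
  | processNow hr =>
    obtain ⟨hS', hext⟩ := hS.moveToConsidered hr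
    exact ⟨⟨hS', trivial⟩, hext⟩
  | processNowEnd _ => exact stay trivial hS
  | compare _ => exact stay trivial hS
  | compareEnd => exact stay trivial hS
  | overlaps _ => exact stay trivial hS
  | overlapsEnd => exact stay trivial hS
  | criticalLeft h =>
    obtain ⟨hS', hext, -⟩ := h.sound hS
    exact ⟨⟨hS', trivial⟩, hext⟩
  | criticalRight h =>
    obtain ⟨hS', hext, -⟩ := h.sound hS
    exact ⟨⟨hS', trivial⟩, hext⟩
  | @criticalGt S R W r todo pairs a b _ _ h =>
    obtain ⟨hS', hext⟩ := hS.insertNew (r := (a, b)) h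
    exact ⟨⟨hS', trivial⟩, hext⟩
  | @criticalLt S R W r todo pairs a b _ _ h =>
    obtain ⟨hS', hext⟩ := hS.insertNew (r := (b, a)) h
    exact ⟨⟨hS', trivial⟩, hext⟩
  | criticalEq _ => exact stay trivial hS
  | prune => exact stay trivial hS
  | normalizeReduce _ h =>
    obtain ⟨hS', hext, -⟩ := h.sound hS
    exact ⟨⟨hS', trivial⟩, hext⟩
  | normalizeWeld _ _ => exact stay trivial hS
  | normalizeEnd _ _ => exact stay trivial hS
  | emptyDelete =>
    obtain ⟨hS', hext⟩ := hS.emptyDelete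
    exact ⟨⟨hS', trivial⟩, hext⟩

variable [Fintype A]

theorem IsInitial.configInv {D : Finset (Rule A)} (hD : ∀ r ∈ D, SL2 r) {c : Config A}
    (hc : IsInitial inv D c) : ConfigInv inv c := by
  obtain ⟨hstore, -, -, hctrl⟩ := hc
  have hall : c.store.all = initialRules inv D := by simp [hstore, Store.all]
  have hactive : c.store.active = initialRules inv D := by
    rw [Store.active, hall]; simp [hstore]
  have hlt : ∀ r ∈ c.store.all, Lt r.2 r.1 := by
    intro r hr
    rw [hall, initialRules, Finset.mem_union, Finset.mem_image] at hr
    rcases hr with hr | ⟨x, -, rfl⟩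
    exacts [(hD r hr).2.1, Lt.of_length (by simp)]
  refine ⟨⟨hlt, fun r hr => Derivable.of_mem ?_ (hlt r hr), fun x => ?_⟩, ?_⟩
  · rwa [hactive, ← hall]
  · refine Conn.of_rule (r := ([x, inv x], [])) ?_ (Lt.of_length (by simp))
    rw [hactive]
    simp [initialRules]
  · rw [hctrl]
    trivial

theorem IsRun.configInv (hinv : Function.Involutive inv) {D : Finset (Rule A)}
    (hD : ∀ r ∈ D, SL2 r) {c : ℕ → Config A} {N : ℕ} (hc : IsRun inv D c N) :
    ∀ n ≤ N, ConfigInv inv (c n) := by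
  intro n
  induction n with
  | zero => exact fun _ => hc.1.configInv hD
  | succ n ih => exact fun hn => ((hc.2 n hn).invariant hinv (ih (by omega))).1

theorem IsRun.extends (hinv : Function.Involutive inv) {D : Finset (Rule A)}
    (hD : ∀ r ∈ D, SL2 r) {c : ℕ → Config A} {N : ℕ} (hc : IsRun inv D c N) {t s : ℕ}
    (hts : t ≤ s) : s ≤ N → Extends (c t).store (c s).store := by
  induction s, hts using Nat.le_induction with
  | base => exact fun h => (hc.configInv hinv hD t h).1.extends_refl
  | succ s _ ih =>
    exact fun h => (ih (by omega)).trans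
      ((hc.2 s h).invariant hinv (hc.configInv hinv hD s (by omega))).2

end Procedure

end KB

theorem mainTheorem4 {A : Type*} [Fintype A] [LinearOrder A] (inv : A → A)
    (hinv : Function.Involutive inv) (D : Finset (KB.Rule A)) (hD : ∀ r ∈ D, KB.SL2 r)
    (c : ℕ → KB.Config A) (N : ℕ) (hc : KB.IsRun inv D c N)
    (t s : ℕ) (hts : t ≤ s) (hsN : s ≤ N) (u v w : KB.Word A) (l : List (KB.Word A))
    (hl : KB.ThuePath (c t) u v l) (hw : KB.IsMaxNode l w) :
    ∃ l' : List (KB.Word A), KB.ThuePath (c s) u v l' ∧ ∀ x ∈ l', KB.Le x w := by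
  obtain ⟨huv, hu⟩ := KB.IsPath.conn hl hw.2
  have hvu := ((hc.extends hinv hD hts hsN).conn huv)
  -- The last step of a non-empty connection bounds `v`; for the empty one, `v` is `u`, bounded as a
  -- node.
  have hv : KB.Le v w := by
    rcases Relation.ReflTransGen.cases_tail huv with rfl | ⟨_, -, h⟩
    exacts [hu, h.2.1]
  exact hvu.exists_isPath hv
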